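/- **Theorem.** A deterministic, work-conserving first-come-first-served scheduler serves one packet per time slot and is shared by an encoder user $U_e$ and a decoder user $U_d$. In each slot each user sends one packet or none; of two packets arriving in the same slot the packet of $U_d$ is queued first; a fixed number $b\ge 0$ of other packets is in the queue at time zero. A code of block length $N\ge 1$ consists of $M\ge 1$ equiprobable binary codewords of length $N$ (bit $i$ of the codeword says whether $U_e$ sends a packet in slot $i$), a binary probe stream of length $N$ sent by $U_d$, fixed in advance or drawn at random independently of the message, and a decoding rule that guesses the message from the probe stream and from the slots in which the probe packets are served. A message is received when the $N$ slots are over and the last probe packet has been served. An $(n,M,\epsilon)$-code is a code with $M$ codewords whose messages take on average $n$ slots to be received, whose average error probability is at most $\epsilon$, and which is stable: the average packet rates (expected number of packets divided by $N$) of the two users satisfy $r_e+r_d<1$. The capacity $C$ (in bits per time slot) is the supremum of the numbers $R$ such that for every $\delta>0$ there are $(n,M,\epsilon_n)$-codes with $\frac{\log_2 M}{n}>R-\delta$ and $\epsilon_n\to 0$ as $n\to\infty$. For $\gamma\in[0,1]$ and an integer $k\ge 1$ let $$\tilde H\Big(\gamma,\frac1k\Big)=\frac1k\max\{H(X): X\in\{0,1,\dots,k\},\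 \mathbb E[X]=k\gamma\},$$ where $H$ is the Shannon entropy in bits. Then, for every $b$, $$C=\max_{\alpha,\gamma_1,\gamma_2}\ \alpha\,\tilde H(\gamma_1,1)+(1-\alpha)\,\tilde H\Big(\gamma_2,\frac12\Big),$$ where the maximum is over all $0\le\alpha\le1$ and $0\le\gamma_1,\gamma_2\le\frac12$ with $$\alpha(\gamma_1+1)+(1-\alpha)\Big(\gamma_2+\frac12\Big)=1.$$ Numerically $C\approx 0.8114$ (that is, $|C-0.8114|\le 5\cdot10^{-5}$), and the maximum is attained at a point with $\alpha\approx0.177$, $\gamma_1\approx0.43$, $\gamma_2\approx0.407$, each correct to the digits given ($|\alpha-0.177|\le 5\cdot 10^{-4}$, $|\gamma_1-0.43|\le 5\cdot10^{-3}$, $|\gamma_2-0.407|\le5\cdot10^{-4}$). -/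

import Mathlib

/-!
A covert timing channel between two users of a deterministic work-conserving FCFS scheduler that
serves one packet per time slot.
-/

noncomputable section

namespace CovertQueue

open Filter Topology

/-! ### The scheduler -/

/-- The packets in the buffer: those of the encoder user, those of the decoder user (the probe
stream), and those that were in the buffer before the transmission starts. -/
inductive Packet where
  | enc
  | probe
  | old

/-- The packets arriving in one slot, in the order in which they join the queue: in the case of
simultaneous arrivals the decoder's packet has priority. -/
def arrivals (d e : Bool) : List Packet :=
  (if d then [Packet.probe] else []) ++ (if e then [Packet.enc] else [])

/-- Content of the FCFS queue in slot `t`, after the arrivals of slot `t` and before the service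
of slot `t`, when `b` packets are buffered at time zero, the decoder's arrival stream is `d` and
the encoder's arrival stream is `e`. In each slot the packet at the head of the line (if there
is one) is served and leaves. -/
def queue (b : ℕ) (d e : ℕ → Bool) : ℕ → List Packet
  | 0 => List.replicate b Packet.old ++ arrivals (d 0) (e 0)
  | t + 1 => (queue b d e t).tail ++ arrivals (d (t + 1)) (e (t + 1))

/-- The output stream seen by the decoder user: whether a packet of the probe stream is served
in slot `t`. -/
def probeOutput (b : ℕ) (d e : ℕ → Bool) (t : ℕ) : Bool :=
  match (queue b d e t).head? with
  | some Packet.probe => true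
  | _ => false

/-- A binary word of length `N` as an arrival stream: one slot per bit, idle afterwards. -/
def stream {N : ℕ} (x : Fin N → Bool) (t : ℕ) : Bool :=
  if h : t < N then x ⟨t, h⟩ else false

/-- Number of packets of a binary word. -/
def weight {N : ℕ} (x : Fin N → Bool) : ℕ := ∑ i, (x i).toNat

/-- Number of slots used until a message is received: all `N` slots of the block are over and the
last probe packet has left the scheduler. -/
def receptionTime (b : ℕ) {N : ℕ} (d e : Fin N → Bool) : ℕ :=
  sInf {T : ℕ | N ≤ T ∧ ∀ t, T ≤ t → probeOutput b (stream d) (stream e) t = false}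

/-- The set whose infimum is the reception time is never empty. -/
theorem receptionTime_nonempty (b : ℕ) {N : ℕ} (d e : Fin N → Bool) :
    {T : ℕ | N ≤ T ∧ ∀ t, T ≤ t →
      probeOutput b (stream d) (stream e) t = false}.Nonempty := by
  have key : ∀ j, (queue b (stream d) (stream e) (N + j)).length ≤
      (queue b (stream d) (stream e) N).length - j := by
    intro j
    induction j with
    | zero => simp
    | succ j ih =>
      have h1 : ¬ (N + j + 1 < N) := by omega
      have h2 : queue b (stream d) (stream e) (N + (j + 1)) =
          (queue b (stream d) (stream e) (N + j)).tail := by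
        rw [← Nat.add_assoc]
        simp [queue, stream, arrivals, h1]
      rw [h2, List.length_tail]
      omega
  refine ⟨N + (queue b (stream d) (stream e) N).length, by omega, fun t ht => ?_⟩
  obtain ⟨j, rfl⟩ : ∃ j, t = N + j := ⟨t - N, by omega⟩
  have h := key j
  have h0 : (queue b (stream d) (stream e) (N + j)).length = 0 := by omega
  simp [probeOutput, List.length_eq_zero_iff.mp h0]

/-! ### Codes, rate, capacity -/

/-- A code: a codebook of `M` binary codewords of length `N`, a probe stream of length `N` drawn
independently of the message (a probe stream fixed in advance is a point mass), and a decoding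
rule, which sees the probe stream and the output stream of the decoder user. -/
structure Code where
  N : ℕ
  N_pos : 0 < N
  M : ℕ
  M_pos : 0 < M
  codeword : Fin M → Fin N → Bool
  probeLaw : (Fin N → Bool) → ℝ
  probeLaw_mem : probeLaw ∈ stdSimplex ℝ (Fin N → Bool)
  decode : (Fin N → Bool) → (ℕ → Bool) → Fin M

/-- Expectation of `f` over the probe stream and the equiprobable message. -/
def Code.mean (c : Code) (f : (Fin c.N → Bool) → Fin c.M → ℝ) : ℝ :=
  ∑ d, c.probeLaw d * ((1 / (c.M : ℝ)) * ∑ w, f d w)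

open Classical in
/-- The average error probability. -/
def Code.errorProb (c : Code) (b : ℕ) : ℝ :=
  c.mean fun d w =>
    if c.decode d (probeOutput b (stream d) (stream (c.codeword w))) = w then 0 else 1

/-- The average number of slots until the message is received. -/
def Code.avgTime (c : Code) (b : ℕ) : ℝ :=
  c.mean fun d w => (receptionTime b d (c.codeword w) : ℝ)

/-- The average packet rate of the encoder user. -/
def Code.encRate (c : Code) : ℝ := c.mean fun _ w => (weight (c.codeword w) : ℝ) / c.N

/-- The average packet rate of the decoder user. -/
def Code.probeRate (c : Code) : ℝ := c.mean fun d _ => (weight d : ℝ) / c.N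

/-- `c` is an `(n, M, ε)`-code over the scheduler with `b` initially buffered packets: `M`
equiprobable codewords, messages take on average `n` slots to be received, the error probability
is at most `ε`, and the queue is stable, i.e. the packet rates add up to less than the service
rate `1`. -/
structure Code.Is (c : Code) (b : ℕ) (n : ℝ) (M : ℕ) (ε : ℝ) : Prop where
  size : c.M = M
  time : c.avgTime b = n
  error : c.errorProb b ≤ ε
  stable : c.encRate + c.probeRate < 1

/-- The rate `R` (in bits per slot) is achievable: for every `δ > 0` there are
`(n, M, εₙ)`-codes with `log₂ M / n > R - δ` and `εₙ → 0` as `n → ∞`. -/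
def Achievable (b : ℕ) (R : ℝ) : Prop :=
  ∀ δ : ℝ, 0 < δ → ∃ (n : ℕ → ℝ) (M : ℕ → ℕ) (ε : ℕ → ℝ),
    (∀ k, ∃ c : Code, c.Is b (n k) (M k) (ε k)) ∧
    (∀ k, R - δ < Real.logb 2 (M k) / n k) ∧
    Tendsto n atTop atTop ∧ Tendsto ε atTop (𝓝 0)

/-- `C` is the capacity: the supremum of the achievable rates. -/
def IsCapacity (b : ℕ) (C : ℝ) : Prop := IsLUB {R : ℝ | Achievable b R} C

/-! ### The maximum entropy function -/

/-- Shannon entropy in bits. -/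
def entropy {k : ℕ} (q : Fin (k + 1) → ℝ) : ℝ := (∑ i, Real.negMulLog (q i)) / Real.log 2

/-- The entropies of the distributions on `{0, …, k}` with mean `k γ`. -/
def entropySet (γ : ℝ) (k : ℕ) : Set ℝ :=
  entropy '' {q | q ∈ stdSimplex ℝ (Fin (k + 1)) ∧ ∑ i : Fin (k + 1), ((i : ℕ) : ℝ) * q i = k * γ}

/-- `Htilde γ k` is `H̃(γ, 1/k)`: the maximum entropy, divided by `k`, of a random variable on
`{0, …, k}` with mean `k γ`. -/
def Htilde (γ : ℝ) (k : ℕ) : ℝ := (1 / (k : ℝ)) * sSup (entropySet γ k)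

/-- The supremum in the definition of `Htilde` is a maximum. -/
theorem isGreatest_entropySet {γ : ℝ} {k : ℕ} (h0 : 0 ≤ γ) (h1 : γ ≤ 1) :
    IsGreatest (entropySet γ k) (sSup (entropySet γ k)) := by
  have hcont : Continuous (entropy (k := k)) := by
    unfold entropy
    exact (continuous_finsetSum _ fun i _ =>
      Real.continuous_negMulLog.comp (continuous_apply i)).div_const _
  have hclosed : IsClosed {q : Fin (k + 1) → ℝ | ∑ i : Fin (k + 1), ((i : ℕ) : ℝ) * q i = k * γ} :=
    isClosed_eq (by fun_prop) continuous_const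
  have hcomp : IsCompact (entropySet γ k) :=
    ((isCompact_stdSimplex ℝ (Fin (k + 1))).inter_right hclosed).image hcont
  have hne : (entropySet γ k).Nonempty := by
    have hmem : ∀ i : Fin (k + 1), (Pi.single i (1 : ℝ) : Fin (k + 1) → ℝ) ∈
        stdSimplex ℝ (Fin (k + 1)) := fun i => single_mem_stdSimplex ℝ i
    refine Set.Nonempty.image _ ⟨(1 - γ) • Pi.single 0 1 + γ • Pi.single (Fin.last k) 1,
      convex_stdSimplex ℝ _ (hmem _) (hmem _) (by linarith) h0 (by ring), ?_⟩
    simp [mul_add, Finset.sum_add_distrib, Pi.single_apply]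
  exact hcomp.isGreatest_sSup hne

/-! ### The optimization problem -/

/-- Feasible triples `(α, γ₁, γ₂)`. -/
structure Feasible (α γ₁ γ₂ : ℝ) : Prop where
  α_mem : α ∈ Set.Icc (0 : ℝ) 1
  γ₁_mem : γ₁ ∈ Set.Icc (0 : ℝ) (1 / 2)
  γ₂_mem : γ₂ ∈ Set.Icc (0 : ℝ) (1 / 2)
  rate_eq : α * (γ₁ + 1) + (1 - α) * (γ₂ + 1 / 2) = 1

/-- The objective `α H̃(γ₁, 1) + (1 - α) H̃(γ₂, 1/2)`. -/
def objective (α γ₁ γ₂ : ℝ) : ℝ := α * Htilde γ₁ 1 + (1 - α) * Htilde γ₂ 2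

end CovertQueue

end

noncomputable section

namespace CovertQueue

open Filter Topology

/-! ### The base of the optimal exponential weights -/

/-! Let x = `base` and charge `price` = -log x nats for every slot and every packet. Stability
bounds the slots and packets of a block of N slots by 2N on average, so the capacity is 2 `price` /
log 2 once the number of distinguishable words is governed by this charge.

Converse: the decoder learns at most how many encoder packets fall between consecutive probe
packets. A gap of k slots contains 0 to k of them and is paid for by k slots and one probe packet,
so it contributes x^(k+1) (1 + x + ... + x^k). By `base_pow_mul_geom_le` this is at most 1 for every
k, with equality for both k = 1 and k = 2. Multiplying over the gaps gives a Kraft inequality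
(`base_pow_mul_sum_weight_le`), and comparison of the correctly decoded words with the Kraft weights
gives `Code.one_sub_errorProb_mul_log_le`. The same weights, by Gibbs' inequality, bound `Htilde` by
an affine function of the mean, with equality for k = 1, 2 at the means of the weights, which solves
the optimization problem.

Achievability: while the server is busy, the output determines the counts at the probes
(`count_eq_of_probeOutput_eq`). Large weight classes with probe periods 1 and 2 are mixed so that
arrivals equal slots (`exists_balanced_codebook`). A full prelude keeps the server busy, and idle
slots at the end empty the queue, giving zero-error codes. -/

theorem exists_base : ∃ x : ℝ, x ^ 3 + x ^ 2 = 1 ∧ 0.7548776 < x ∧ x < 0.7548777 := by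
  have hc : ContinuousOn (fun x : ℝ => x ^ 3 + x ^ 2) (Set.Icc 0.7548776 0.7548777) := by fun_prop
  obtain ⟨x, hx, h⟩ := intermediate_value_Ioo (by norm_num) hc
    (show (1 : ℝ) ∈ Set.Ioo _ _ by constructor <;> norm_num)
  exact ⟨x, h, hx.1, hx.2⟩

/-- The real root of `x ^ 3 + x ^ 2 = 1`. -/
def base : ℝ := exists_base.choose

theorem base_eq : base ^ 3 + base ^ 2 = 1 := exists_base.choose_spec.1

theorem lt_base : 0.7548776 < base := exists_base.choose_spec.2.1

theorem base_lt : base < 0.7548777 := exists_base.choose_spec.2.2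

theorem base_pos : 0 < base := lt_trans (by norm_num) lt_base

theorem base_lt_one : base < 1 := lt_trans base_lt (by norm_num)

/-- The price of one packet, in nats. -/
def price : ℝ := -Real.log base

theorem price_pos : 0 < price := neg_pos.2 (Real.log_neg base_pos base_lt_one)

theorem log_base_pow (n : ℕ) : Real.log (base ^ n) = -(n * price) := by
  rw [Real.log_pow, price]; ring

/-- The generating function of `{0, …, k}` at `base`. -/
def geom (k : ℕ) : ℝ := ∑ j ∈ Finset.range (k + 1), base ^ j

theorem geom_pos (k : ℕ) : 0 < geom k :=
  Finset.sum_pos (fun _ _ => pow_pos base_pos _) ⟨0, by simp⟩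

theorem base_pow_mul_geom_one : base ^ 2 * geom 1 = 1 := by
  simp only [geom, Finset.sum_range_succ, Finset.sum_range_zero]
  linear_combination base_eq

theorem base_pow_five : base ^ 5 = 1 - base := by
  linear_combination (base ^ 2 - base + 1) * base_eq

/-- The same root serves both periods because x^5 + x - 1 is divisible by x^3 + x^2 - 1. This
coincidence is why periods 1 and 2 are both optimal. -/
theorem base_pow_mul_geom_two : base ^ 3 * geom 2 = 1 := by
  simp only [geom, Finset.sum_range_succ, Finset.sum_range_zero]
  linear_combination base_pow_five + base * base_eq

/-- Passing from k to k + 1 multiplies the left side by x and adds x^(2k+3). For k ≥ 1 the added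
term is at most x^5 = 1 - x, so the bound 1 persists. -/
theorem base_pow_mul_geom_le (k : ℕ) : base ^ (k + 1) * geom k ≤ 1 := by
  induction k with
  | zero => simpa [geom] using base_lt_one.le
  | succ k ih =>
    rcases Nat.eq_zero_or_pos k with rfl | hk
    · exact base_pow_mul_geom_one.le
    · have h1 : geom (k + 1) = geom k + base ^ (k + 1) := Finset.sum_range_succ _ _
      have h2 : base ^ (2 * k + 3) ≤ base ^ 5 :=
        pow_le_pow_of_le_one base_pos.le base_lt_one.le (by omega)
      calc base ^ (k + 1 + 1) * geom (k + 1)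
          = base * (base ^ (k + 1) * geom k) + base ^ (2 * k + 3) := by rw [h1]; ring
        _ ≤ base * 1 + base ^ 5 := add_le_add (mul_le_mul_of_nonneg_left ih base_pos.le) h2
        _ = 1 := by rw [base_pow_five]; ring

theorem log_geom_one : Real.log (geom 1) = 2 * price := by
  have h := congrArg Real.log base_pow_mul_geom_one
  rw [Real.log_mul (pow_pos base_pos _).ne' (geom_pos _).ne', log_base_pow, Real.log_one] at h
  push_cast at h; linarith

theorem log_geom_two : Real.log (geom 2) = 3 * price := by
  have h := congrArg Real.log base_pow_mul_geom_two
  rw [Real.log_mul (pow_pos base_pos _).ne' (geom_pos _).ne', log_base_pow, Real.log_one] at h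
  push_cast at h; linarith

/-- The capacity in bits per slot. -/
def capacity : ℝ := 2 * price / Real.log 2

/-! ### The queue seen by the probe packets -/

/-- Number of packets of an arrival stream before slot `t`. -/
def count (f : ℕ → Bool) (t : ℕ) : ℕ := ∑ i ∈ Finset.range t, (f i).toNat

@[simp] theorem count_zero (f : ℕ → Bool) : count f 0 = 0 := rfl

theorem count_succ (f : ℕ → Bool) (t : ℕ) : count f (t + 1) = count f t + (f t).toNat :=
  Finset.sum_range_succ _ _

theorem count_mono (f : ℕ → Bool) : Monotone (count f) :=
  monotone_nat_of_le_succ fun t => by rw [count_succ]; omega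

theorem count_lt_count {f : ℕ → Bool} {s t : ℕ} (hs : f s = true) (h : s < t) :
    count f s < count f t := by
  have := count_mono f (Nat.succ_le_of_lt h)
  rw [Nat.succ_eq_add_one, count_succ, hs] at this
  simp at this
  omega

theorem count_le_add (f : ℕ → Bool) {s t : ℕ} (h : s ≤ t) : count f t ≤ count f s + (t - s) := by
  induction t, h using Nat.le_induction with
  | base => simp
  | succ t h ih => rw [count_succ]; have := Bool.toNat_le (f t); omega

/-- Number of packets in the queue that are ahead of those arriving in slot `t`. -/
def backlog (b : ℕ) (d e : ℕ → Bool) : ℕ → ℕ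
  | 0 => b
  | t + 1 => backlog b d e t + (d t).toNat + (e t).toNat - 1

theorem length_arrivals (x y : Bool) : (arrivals x y).length = x.toNat + y.toNat := by
  cases x <;> cases y <;> rfl

theorem length_queue (b : ℕ) (d e : ℕ → Bool) (t : ℕ) :
    (queue b d e t).length = backlog b d e t + (d t).toNat + (e t).toNat := by
  induction t with
  | zero => simp [queue, backlog, length_arrivals, add_assoc]
  | succ t ih =>
    rw [queue, List.length_append, List.length_tail, ih, length_arrivals, backlog]; omega

theorem getElem?_arrivals (x y : Bool) (i : ℕ) :
    (arrivals x y)[i]? = some Packet.probe ↔ x = true ∧ i = 0 := by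
  rcases i with _ | _ | i <;> cases x <;> cases y <;> simp [arrivals]

/-- Under FCFS a probe arriving in slot s moves up one place per slot, so slot plus position stays
equal to its service slot `s + backlog b d e s`. -/
theorem getElem?_queue (b : ℕ) (d e : ℕ → Bool) (t i : ℕ) :
    (queue b d e t)[i]? = some Packet.probe ↔
      ∃ s, s ≤ t ∧ d s = true ∧ t + i = s + backlog b d e s := by
  induction t generalizing i with
  | zero =>
    rw [queue, List.getElem?_append]
    split_ifs with h
    · rw [List.length_replicate] at h
      simp only [List.getElem?_replicate, h, if_true]
      constructor
      · intro h'; simp at h'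
      · rintro ⟨s, hs, -, h'⟩
        obtain rfl : s = 0 := by omega
        simp only [backlog] at h'; omega
    · rw [List.length_replicate] at h ⊢
      rw [getElem?_arrivals]
      constructor
      · rintro ⟨h1, h2⟩
        exact ⟨0, le_rfl, h1, by simp only [backlog]; omega⟩
      · rintro ⟨s, hs, hd, h'⟩
        obtain rfl : s = 0 := by omega
        simp only [backlog] at h'
        exact ⟨hd, by omega⟩
  | succ t ih =>
    have hl : (queue b d e t).tail.length = backlog b d e (t + 1) := by
      rw [List.length_tail, length_queue, backlog]
    rw [queue, List.getElem?_append]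
    split_ifs with h
    · rw [hl] at h
      rw [List.getElem?_tail, ih]
      constructor
      · rintro ⟨s, hs, hd, h'⟩
        exact ⟨s, by omega, hd, by omega⟩
      · rintro ⟨s, hs, hd, h'⟩
        rcases Nat.lt_or_ge t s with h2 | h2
        · obtain rfl : s = t + 1 := by omega
          omega
        · exact ⟨s, h2, hd, by omega⟩
    · rw [hl] at h ⊢
      rw [getElem?_arrivals]
      constructor
      · rintro ⟨h1, h2⟩
        exact ⟨t + 1, le_rfl, h1, by omega⟩
      · rintro ⟨s, hs, hd, h'⟩
        rcases Nat.lt_or_ge t s with h2 | h2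
        · obtain rfl : s = t + 1 := by omega
          exact ⟨hd, by omega⟩
        · have h3 := (ih (i + 1)).2 ⟨s, h2, hd, by omega⟩
          have h4 := (List.getElem?_eq_some_iff.1 h3).1
          rw [List.length_tail] at hl
          omega

theorem probeOutput_eq_true_iff (b : ℕ) (d e : ℕ → Bool) (t : ℕ) :
    probeOutput b d e t = true ↔ ∃ s, d s = true ∧ t = s + backlog b d e s := by
  have h : probeOutput b d e t = true ↔ (queue b d e t)[0]? = some Packet.probe := by
    rw [probeOutput, List.head?_eq_getElem?]
    rcases (queue b d e t)[0]? with _ | (_ | _ | _) <;> simp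
  rw [h, getElem?_queue]
  constructor
  · rintro ⟨s, -, hd, h'⟩; exact ⟨s, hd, by omega⟩
  · rintro ⟨s, hd, h'⟩; exact ⟨s, by omega, hd, by omega⟩

/-- The output stream depends on the encoder's stream only through the numbers of encoder packets
that arrived before the probe packets. -/
theorem probeOutput_congr (b : ℕ) {d e e' : ℕ → Bool}
    (h : ∀ s, d s = true → count e s = count e' s) :
    probeOutput b d e = probeOutput b d e' := by
  -- Between probe arrivals the truncated recursion gives the positive part of the count plus a
  -- shift c common to both streams. In a slot with a probe arrival the counts, hence the backlogs,
  -- agree and nothing is truncated, so c can be reset.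
  have key : ∀ t, ∃ c : ℤ, backlog b d e t = (count e t + c).toNat ∧
      backlog b d e' t = (count e' t + c).toNat := by
    intro t
    induction t with
    | zero => exact ⟨b, by simp [backlog]⟩
    | succ t ih =>
      obtain ⟨c, h1, h2⟩ := ih
      simp only [backlog, count_succ]
      have he := Bool.toNat_le (e t)
      have he' := Bool.toNat_le (e' t)
      cases hd : d t
      · refine ⟨c - 1, ?_, ?_⟩ <;> simp only [Bool.toNat_false] <;> omega
      · have := h t hd
        refine ⟨(backlog b d e t : ℤ) - count e t, ?_, ?_⟩ <;>
          simp only [Bool.toNat_true] <;> omega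
  have hb : ∀ s, d s = true → backlog b d e s = backlog b d e' s := by
    intro s hs
    obtain ⟨c, h1, h2⟩ := key s
    rw [h1, h2, h s hs]
  funext t
  rw [Bool.eq_iff_iff, probeOutput_eq_true_iff, probeOutput_eq_true_iff]
  exact exists_congr fun s => and_congr_right fun hs => by rw [hb s hs]

/-- If at least t packets are available before every slot t, no service is wasted and the truncated
subtraction in `backlog` never truncates. -/
theorem backlog_eq_of_busy {b : ℕ} {d e : ℕ → Bool} {n : ℕ}
    (h : ∀ t ≤ n, t ≤ b + count d t + count e t) {t : ℕ} (ht : t ≤ n) :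
    t + backlog b d e t = b + count d t + count e t := by
  induction t with
  | zero => simp [backlog]
  | succ t ih =>
    have h1 := ih (by omega)
    have h2 := h (t + 1) ht
    simp only [backlog, count_succ] at *
    omega

/-- As long as the server is busy, the output stream reveals the numbers of encoder packets that
arrived before the probe packets. -/
theorem count_eq_of_probeOutput_eq {b : ℕ} {d e e' : ℕ → Bool} {n : ℕ}
    (hd : ∀ s, d s = true → s ≤ n)
    (h : ∀ t ≤ n, t ≤ b + count d t + count e t)
    (h' : ∀ t ≤ n, t ≤ b + count d t + count e' t)
    (ho : probeOutput b d e = probeOutput b d e') :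
    ∀ s, d s = true → count e s = count e' s := by
  intro s
  induction s using Nat.strong_induction_on with
  | _ s ih =>
  intro hs
  have aux : ∀ f f' : ℕ → Bool, (∀ t ≤ n, t ≤ b + count d t + count f t) →
      (∀ t ≤ n, t ≤ b + count d t + count f' t) → probeOutput b d f = probeOutput b d f' →
      (∀ r < s, d r = true → count f r = count f' r) → count f' s ≤ count f s := by
    intro f f' hf hf' hff ih
    by_contra! hlt
    -- The departure slot of probe s under f must be that of some probe r under f'. Departure slots
    -- increase with the probe, so r < s (where the counts agree) leaves too early, and r ≥ s too
    -- late.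
    have h1 : probeOutput b d f' (s + backlog b d f s) = true := by
      rw [← hff, probeOutput_eq_true_iff]; exact ⟨s, hs, rfl⟩
    obtain ⟨r, hr, h2⟩ := (probeOutput_eq_true_iff ..).1 h1
    rw [backlog_eq_of_busy hf (hd s hs), backlog_eq_of_busy hf' (hd r hr)] at h2
    rcases Nat.lt_or_ge r s with h3 | h3
    · have h4 := ih r h3 hr
      have h5 := count_lt_count hr h3
      have h6 := count_mono f h3.le
      omega
    · have h5 := count_mono d h3
      have h6 := count_mono f' h3
      omega
  exact le_antisymm (aux e' e h' h ho.symm fun r hr hdr => (ih r hr hdr).symm)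
    (aux e e' h h' ho ih)

theorem stream_of_lt {N : ℕ} (x : Fin N → Bool) {t : ℕ} (h : t < N) : stream x t = x ⟨t, h⟩ := by
  simp [stream, h]

theorem lt_of_stream {N : ℕ} {x : Fin N → Bool} {t : ℕ} (h : stream x t = true) : t < N := by
  by_contra hn
  simp [stream, hn] at h

theorem count_stream {N : ℕ} (x : Fin N → Bool) : count (stream x) N = weight x := by
  rw [count, weight, Finset.sum_range]
  exact Finset.sum_congr rfl fun i _ => by rw [stream_of_lt x i.2]

theorem le_receptionTime (b : ℕ) {N : ℕ} (d e : Fin N → Bool) : N ≤ receptionTime b d e :=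
  (Nat.sInf_mem (receptionTime_nonempty b d e)).1

/-! ### The converse -/

theorem exists_last_arrival (d : ℕ → Bool) (t : ℕ) :
    (∀ r < t, d r = false) ∧ count d t = 0 ∨
      ∃ s < t, d s = true ∧ count d t = count d s + 1 ∧ ∀ r < t, d r = true → r ≤ s := by
  induction t with
  | zero => exact Or.inl ⟨fun r hr => absurd hr (Nat.not_lt_zero r), rfl⟩
  | succ t ih =>
    cases hd : d t
    · rcases ih with ⟨h1, h2⟩ | ⟨s, hs, h1, h2, h3⟩
      · refine Or.inl ⟨fun r hr => ?_, by rw [count_succ, h2, hd]; rfl⟩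
        rcases Nat.lt_succ_iff_lt_or_eq.1 hr with h | rfl
        exacts [h1 r h, hd]
      · refine Or.inr ⟨s, by omega, h1, by rw [count_succ, h2, hd]; rfl, fun r hr hdr => ?_⟩
        rcases Nat.lt_succ_iff_lt_or_eq.1 hr with h | rfl
        · exact h3 r h hdr
        · simp [hd] at hdr
    · exact Or.inr ⟨t, by omega, hd, by rw [count_succ, hd]; rfl, fun r hr _ => by omega⟩

/-- A Kraft inequality for streams told apart by their counts in slot `t` and at the arrivals of
`d` before slot `t`. -/
theorem base_pow_mul_sum_le {ι : Type*} (d : ℕ → Bool) (e : ι → ℕ → Bool) (t : ℕ) (S : Finset ι)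
    (hS : ∀ w ∈ S, ∀ w' ∈ S, (∀ s ≤ t, s = t ∨ d s = true → count (e w) s = count (e w') s) →
      w = w') :
    base ^ (t + count d t + 1) * ∑ w ∈ S, base ^ count (e w) t ≤ 1 := by
  classical
  induction t using Nat.strong_induction_on generalizing S with
  | _ t ih =>
  rcases exists_last_arrival d t with ⟨h1, h2⟩ | ⟨s, hs, h1, h2, h3⟩
  · have hinj : Set.InjOn (fun w => count (e w) t) S := by
      intro w hw w' hw' h
      refine hS w hw w' hw' fun s hs hsd => ?_
      rcases hs.lt_or_eq with hlt | rfl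
      · rcases hsd with rfl | hsd
        · exact h
        · simp [h1 s hlt] at hsd
      · exact h
    have hsum : ∑ w ∈ S, base ^ count (e w) t ≤ geom t := by
      rw [← Finset.sum_image (f := fun j => base ^ j) hinj]
      refine Finset.sum_le_sum_of_subset_of_nonneg ?_ fun _ _ _ => (pow_pos base_pos _).le
      intro j hj
      obtain ⟨w, -, rfl⟩ := Finset.mem_image.1 hj
      have := count_le_add (e w) (Nat.zero_le t)
      simp only [count_zero] at this
      exact Finset.mem_range.2 (by omega)
    calc _ ≤ base ^ (t + 1) * geom t := by
            rw [h2]; exact mul_le_mul_of_nonneg_left hsum (pow_pos base_pos _).le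
      _ ≤ 1 := base_pow_mul_geom_le t
  · have hmaps : ∀ w ∈ S, count (e w) t - count (e w) s ∈ Finset.range (t - s + 1) := by
      intro w _
      have := count_le_add (e w) hs.le
      exact Finset.mem_range.2 (by omega)
    -- Fibre over the number j of encoder packets since the last probe s. Within a fibre agreement
    -- at s forces agreement at t, so the induction hypothesis applies at s, and the fibres together
    -- contribute `geom (t - s)`.
    rw [← Finset.sum_fiberwise_of_maps_to hmaps]
    have hfib : ∀ j ∈ Finset.range (t - s + 1),
        base ^ (s + count d s + 1) *
          ∑ w ∈ S with count (e w) t - count (e w) s = j, base ^ count (e w) t ≤ base ^ j := by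
      intro j _
      have h4 : ∑ w ∈ S with count (e w) t - count (e w) s = j, base ^ count (e w) t =
          (∑ w ∈ S with count (e w) t - count (e w) s = j, base ^ count (e w) s) * base ^ j := by
        rw [Finset.sum_mul]
        refine Finset.sum_congr rfl fun w hw => ?_
        rw [← pow_add, ← (Finset.mem_filter.1 hw).2]
        have := count_mono (e w) hs.le
        congr 1; omega
      rw [h4, ← mul_assoc]
      refine mul_le_of_le_one_left (pow_pos base_pos _).le (ih s hs _ ?_)
      intro w hw w' hw' hww
      rw [Finset.mem_filter] at hw hw'
      refine hS w hw.1 w' hw'.1 fun r hr hrd => ?_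
      have hst := hww s le_rfl (Or.inl rfl)
      have hend : count (e w) t = count (e w') t := by
        have := count_mono (e w) hs.le
        have := count_mono (e w') hs.le
        omega
      rcases hr.lt_or_eq with hlt | rfl
      · rcases hrd with rfl | hrd
        · exact hend
        · exact hww r (h3 r hlt hrd) (Or.inr hrd)
      · exact hend
    have hexp : t + count d t + 1 = (t - s + 1) + (s + count d s + 1) := by omega
    rw [hexp, pow_add, mul_assoc, Finset.mul_sum]
    exact le_trans (mul_le_mul_of_nonneg_left (Finset.sum_le_sum hfib) (pow_pos base_pos _).le)
      (base_pow_mul_geom_le _)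

/-- A Kraft inequality for words with distinct output streams. -/
theorem base_pow_mul_sum_weight_le {ι : Type*} {N : ℕ} (b : ℕ) (d : Fin N → Bool)
    (c : ι → Fin N → Bool) (S : Finset ι)
    (hS : Set.InjOn (fun w => probeOutput b (stream d) (stream (c w))) S) :
    base ^ (N + weight d) * ∑ w ∈ S, base ^ weight (c w) ≤ 1 := by
  rcases exists_last_arrival (stream d) N with ⟨h1, -⟩ | ⟨s, hs, h1, h2, h3⟩
  · have hsub : ∀ w ∈ S, ∀ w' ∈ S, w = w' := fun w hw w' hw' => hS hw hw' <|
      probeOutput_congr b fun s hs => by simp [h1 s (lt_of_stream hs)] at hs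
    have hone : ∀ n, base ^ n ≤ 1 := fun n => pow_le_one₀ base_pos.le base_lt_one.le
    rcases S.eq_empty_or_nonempty with rfl | ⟨w, hw⟩
    · simp
    · obtain rfl : S = {w} := Finset.eq_singleton_iff_unique_mem.2 ⟨hw, fun w' hw' =>
        hsub w' hw' w hw⟩
      rw [Finset.sum_singleton]
      exact mul_le_one₀ (hone _) (pow_pos base_pos _).le (hone _)
  -- Encoder packets arriving from the slot s of the last probe on are invisible. Discarding them
  -- and the later slots only enlarges the Kraft sum.
  · refine le_trans ?_ (base_pow_mul_sum_le (stream d) (fun w => stream (c w)) s S ?_)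
    · rw [count_stream] at h2
      refine mul_le_mul ?_ ?_ ?_ (pow_pos base_pos _).le
      · exact pow_le_pow_of_le_one base_pos.le base_lt_one.le (by omega)
      · refine Finset.sum_le_sum fun w _ => ?_
        rw [← count_stream]
        exact pow_le_pow_of_le_one base_pos.le base_lt_one.le (count_mono _ hs.le)
      · exact Finset.sum_nonneg fun _ _ => (pow_pos base_pos _).le
    · intro w hw w' hw' h
      refine hS hw hw' (probeOutput_congr b fun r hr => ?_)
      exact h r (h3 r (lt_of_stream hr) hr) (Or.inr hr)

/-- Gibbs' inequality for the uniform law on S against the Kraft weights: apply 1 + u ≤ exp u with u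
= log |S| minus the charge of the word, then sum. -/
theorem card_mul_log_card_le {ι : Type*} {N : ℕ} (b : ℕ) (d : Fin N → Bool)
    (c : ι → Fin N → Bool) (S : Finset ι)
    (hS : Set.InjOn (fun w => probeOutput b (stream d) (stream (c w))) S) :
    (S.card : ℝ) * Real.log S.card ≤ price * ∑ w ∈ S, ((weight (c w) : ℝ) + N + weight d) := by
  rcases S.eq_empty_or_nonempty with rfl | hne
  · simp
  have hcard : (0 : ℝ) < S.card := by exact_mod_cast hne.card_pos
  have hK := base_pow_mul_sum_weight_le b d c S hS
  have hterm : ∀ w ∈ S, (Real.log S.card - price * ((weight (c w) : ℝ) + N + weight d)) + 1 ≤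
      S.card * (base ^ (N + weight d) * base ^ weight (c w)) := by
    intro w _
    refine (Real.add_one_le_exp _).trans_eq ?_
    rw [sub_eq_add_neg, Real.exp_add, Real.exp_log hcard, ← pow_add,
      ← Real.exp_log (pow_pos base_pos (N + weight d + weight (c w))), log_base_pow]
    push_cast
    ring_nf
  have hsum := Finset.sum_le_sum hterm
  rw [← Finset.mul_sum, ← Finset.mul_sum, Finset.sum_add_distrib, Finset.sum_sub_distrib,
    ← Finset.mul_sum] at hsum
  simp only [Finset.sum_const, nsmul_eq_mul, mul_one] at hsum
  have := mul_le_mul_of_nonneg_left hK hcard.le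
  linarith

/-! ### From the Kraft inequality to a bound on the rate of a code. -/

namespace Code

theorem mean_mono (c : Code) {f g : (Fin c.N → Bool) → Fin c.M → ℝ} (h : ∀ d w, f d w ≤ g d w) :
    c.mean f ≤ c.mean g := by
  refine Finset.sum_le_sum fun d _ => mul_le_mul_of_nonneg_left ?_ (c.probeLaw_mem.1 d)
  exact mul_le_mul_of_nonneg_left (Finset.sum_le_sum fun w _ => h d w) (by positivity)

theorem mean_add (c : Code) (f g : (Fin c.N → Bool) → Fin c.M → ℝ) :
    c.mean (fun d w => f d w + g d w) = c.mean f + c.mean g := by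
  simp only [mean, Finset.sum_add_distrib, mul_add]

theorem mean_const_mul (c : Code) (a : ℝ) (f : (Fin c.N → Bool) → Fin c.M → ℝ) :
    c.mean (fun d w => a * f d w) = a * c.mean f := by
  simp only [mean, Finset.mul_sum]
  exact Finset.sum_congr rfl fun d _ => Finset.sum_congr rfl fun w _ => by ring

theorem M_cast_pos (c : Code) : (0 : ℝ) < c.M := by exact_mod_cast c.M_pos

theorem N_cast_pos (c : Code) : (0 : ℝ) < c.N := by exact_mod_cast c.N_pos

theorem mean_const (c : Code) (a : ℝ) : c.mean (fun _ _ => a) = a := by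
  have h := c.M_cast_pos.ne'
  simp only [mean, Finset.sum_const, Finset.card_univ, Fintype.card_fin, nsmul_eq_mul]
  rw [← Finset.sum_mul, c.probeLaw_mem.2]
  field_simp

theorem N_le_avgTime (c : Code) (b : ℕ) : (c.N : ℝ) ≤ c.avgTime b := by
  rw [← c.mean_const c.N]
  exact c.mean_mono fun d w => by exact_mod_cast le_receptionTime b d _

/-- Fano's inequality, for a fixed probe stream. -/
theorem fraction_mul_log_le (c : Code) (b : ℕ) (d : Fin c.N → Bool) (S : Finset (Fin c.M))
    (hS : Set.InjOn (fun w => probeOutput b (stream d) (stream (c.codeword w))) S) :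
    (S.card : ℝ) / c.M * Real.log c.M - 1 ≤
      (1 / (c.M : ℝ)) * ∑ w, price * ((weight (c.codeword w) : ℝ) + c.N + weight d) := by
  have hM := c.M_cast_pos
  have h1 : (S.card : ℝ) * Real.log S.card ≤
      ∑ w, price * ((weight (c.codeword w) : ℝ) + c.N + weight d) := by
    refine (card_mul_log_card_le b d c.codeword S hS).trans ?_
    rw [Finset.mul_sum]
    exact Finset.sum_le_sum_of_subset_of_nonneg (Finset.subset_univ _) fun w _ _ =>
      mul_nonneg price_pos.le (by positivity)
  -- Replacing log |S| by log M costs at most M in total, by log y ≤ y - 1 at y = M / |S|. This is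
  -- one nat per message.
  have h2 : (S.card : ℝ) * Real.log c.M - c.M ≤ S.card * Real.log S.card := by
    rcases S.eq_empty_or_nonempty with rfl | hne
    · simp
    have hcard : (0 : ℝ) < S.card := by exact_mod_cast hne.card_pos
    have h3 := Real.log_le_sub_one_of_pos (div_pos hM hcard)
    rw [Real.log_div hM.ne' hcard.ne'] at h3
    have h4 := mul_le_mul_of_nonneg_left h3 hcard.le
    have h5 : (S.card : ℝ) * (c.M / S.card - 1) = c.M - S.card := by field_simp
    rw [h5] at h4
    linarith
  calc (S.card : ℝ) / c.M * Real.log c.M - 1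
      = (1 / (c.M : ℝ)) * (S.card * Real.log c.M - c.M) := by field_simp
    _ ≤ _ := mul_le_mul_of_nonneg_left (h2.trans h1) (by positivity)

/-- For each probe stream the correctly decoded messages have distinct outputs, so the fixed-stream
bound can be averaged. The mean charge is `price * N * (encRate + 1 + probeRate)`, where stability
enters. -/
theorem one_sub_errorProb_mul_log_le (c : Code) (b : ℕ)
    (hst : c.encRate + c.probeRate < 1) :
    (1 - c.errorProb b) * Real.log c.M - 1 ≤ 2 * price * c.N := by
  classical
  have hM := c.M_cast_pos
  have hN := c.N_cast_pos
  have h1 : c.mean (fun d w => price * ((weight (c.codeword w) : ℝ) + c.N + weight d)) =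
      price * (c.N * (c.encRate + 1 + c.probeRate)) := by
    rw [mean_const_mul, mean_add, mean_add, mean_const, encRate, probeRate]
    have h2 : ∀ f : (Fin c.N → Bool) → Fin c.M → ℝ, c.mean f = c.N * c.mean fun d w => f d w / c.N := by
      intro f
      rw [← mean_const_mul]
      congr 1; funext d w; field_simp
    rw [h2 fun d w => (weight (c.codeword w) : ℝ), h2 fun d w => (weight d : ℝ)]
    ring
  have h3 : (1 - c.errorProb b) * Real.log c.M - 1 ≤
      c.mean (fun d w => price * ((weight (c.codeword w) : ℝ) + c.N + weight d)) := by
    have h4 : (1 - c.errorProb b) * Real.log c.M - 1 =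
        ∑ d, c.probeLaw d * (((Finset.univ.filter fun w => c.decode d
          (probeOutput b (stream d) (stream (c.codeword w))) = w).card : ℝ) / c.M *
            Real.log c.M - 1) := by
      have h5 : 1 - c.errorProb b = ∑ d, c.probeLaw d * (((Finset.univ.filter fun w => c.decode d
          (probeOutput b (stream d) (stream (c.codeword w))) = w).card : ℝ) / c.M) := by
        rw [errorProb, mean]
        nth_rewrite 1 [← c.probeLaw_mem.2]
        rw [← Finset.sum_sub_distrib]
        refine Finset.sum_congr rfl fun d _ => ?_
        have h6 : ∀ w : Fin c.M, (if c.decode d (probeOutput b (stream d)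
            (stream (c.codeword w))) = w then (0 : ℝ) else 1) =
            1 - if c.decode d (probeOutput b (stream d) (stream (c.codeword w))) = w
              then 1 else 0 := fun w => by split_ifs <;> simp
        simp only [h6, Finset.sum_sub_distrib, Finset.sum_const, Finset.card_univ,
          Fintype.card_fin, nsmul_eq_mul, mul_one, Finset.sum_boole]
        field_simp
        ring
      simp only [h5, mul_sub, mul_one, Finset.sum_sub_distrib, c.probeLaw_mem.2, Finset.sum_mul,
        mul_assoc]
    rw [h4]
    refine Finset.sum_le_sum fun d _ => mul_le_mul_of_nonneg_left ?_ (c.probeLaw_mem.1 d)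
    refine c.fraction_mul_log_le b d _ ?_
    intro w hw w' hw' hww
    simp only [Finset.coe_filter, Finset.mem_univ, true_and, Set.mem_ofPred_eq] at hw hw' hww
    rw [← hw, ← hw', hww]
  rw [h1] at h3
  have := mul_le_mul_of_nonneg_left hst.le (mul_pos price_pos hN).le
  nlinarith

end Code

/-- The mean reception time n is at least N, so the bound survives division by n, and the error term
and the lost nat vanish in the limit. -/
theorem Achievable.le_capacity {b : ℕ} {R : ℝ} (hR : Achievable b R) : R ≤ capacity := by
  have hlog2 : 0 < Real.log 2 := Real.log_pos one_lt_two
  refine le_of_forall_pos_sub_le fun δ hδ => ?_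
  obtain ⟨n, M, ε, hcode, hrate, hn, hε⟩ := hR δ hδ
  have hlim1 : Tendsto (fun k => (1 - ε k) * (R - δ)) atTop (𝓝 ((1 - 0) * (R - δ))) :=
    (tendsto_const_nhds.sub hε).mul_const _
  have hlim2 : Tendsto (fun k => (Real.log 2)⁻¹ * (n k)⁻¹ + capacity) atTop
      (𝓝 ((Real.log 2)⁻¹ * 0 + capacity)) :=
    (hn.inv_tendsto_atTop.const_mul _).add_const _
  have hle := le_of_tendsto_of_tendsto hlim1 hlim2 ?_
  · simpa using hle
  filter_upwards [hn.eventually_gt_atTop 0, hε.eventually_lt_const one_pos] with k hk hek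
  obtain ⟨c, hc⟩ := hcode k
  have h1 := c.one_sub_errorProb_mul_log_le b hc.stable
  have h2 := c.N_le_avgTime b
  have h3 := hrate k
  have hlogM : 0 ≤ Real.log c.M := Real.log_natCast_nonneg _
  rw [hc.size] at h1 hlogM
  rw [hc.time] at h2
  have h4 : (1 - ε k) * Real.log (M k) ≤ 2 * price * n k + 1 := by
    have h5 := mul_le_mul_of_nonneg_right (sub_le_sub_left hc.error 1) hlogM
    have h6 := mul_le_mul_of_nonneg_left h2 (mul_pos two_pos price_pos).le
    linarith
  calc (1 - ε k) * (R - δ) ≤ (1 - ε k) * (Real.logb 2 (M k) / n k) :=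
        mul_le_mul_of_nonneg_left h3.le (by linarith)
    _ = ((1 - ε k) * Real.log (M k)) * ((Real.log 2)⁻¹ * (n k)⁻¹) := by
        rw [Real.logb]; field_simp
    _ ≤ (2 * price * n k + 1) * ((Real.log 2)⁻¹ * (n k)⁻¹) :=
        mul_le_mul_of_nonneg_right h4 (by positivity)
    _ = (Real.log 2)⁻¹ * (n k)⁻¹ + capacity := by
        rw [capacity]; field_simp; ring

/-! ### The optimization problem -/

set_option exponentiation.threshold 400 in
theorem capacity_mem : capacity ∈ Set.Icc (0.81135 : ℝ) 0.81145 := by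
  have hlog2 : 0 < Real.log 2 := Real.log_pos one_lt_two
  -- The fractions 157/387 and 71/175 enclose `price / log 2` closely enough for the required digits
  -- of its double.
  have h1 : base ^ 387 ≤ (2 ^ 157)⁻¹ :=
    (pow_le_pow_left₀ base_pos.le base_lt.le 387).trans (by norm_num)
  have h2 : (2 ^ 71)⁻¹ ≤ base ^ 175 :=
    le_trans (by norm_num) (pow_le_pow_left₀ (by norm_num) lt_base.le 175)
  have h3 := Real.log_le_log (pow_pos base_pos _) h1
  have h4 := Real.log_le_log (by positivity) h2
  rw [log_base_pow, Real.log_inv, Real.log_pow] at h3 h4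
  push_cast at h3 h4
  rw [capacity]
  constructor
  · rw [le_div_iff₀ hlog2]; linarith
  · rw [div_le_iff₀ hlog2]; linarith

theorem geom_eq_sum_fin (k : ℕ) : geom k = ∑ i : Fin (k + 1), base ^ (i : ℕ) :=
  Finset.sum_range _

/-- Gibbs' inequality against the weights x^(k+1+i), whose total is at most 1. Their logarithms are
affine in i, so only the mean of q remains. -/
theorem entropy_le {γ : ℝ} {k : ℕ} {v : ℝ} (hv : v ∈ entropySet γ k) :
    v ≤ price * (k + 1 + k * γ) / Real.log 2 := by
  obtain ⟨q, ⟨hq, hmean⟩, rfl⟩ := hv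
  refine div_le_div_of_nonneg_right ?_ (Real.log_pos one_lt_two).le
  have hterm : ∀ i : Fin (k + 1), Real.negMulLog (q i) ≤
      price * ((k + 1) * q i + (i : ℕ) * q i) + (base ^ (k + 1) * base ^ (i : ℕ) - q i) := by
    intro i
    rcases (hq.1 i).eq_or_lt with h | h
    · rw [← h]; simpa using (mul_pos (pow_pos base_pos (k + 1)) (pow_pos base_pos (i : ℕ))).le
    · have hr : 0 < base ^ (k + 1 + (i : ℕ)) := pow_pos base_pos _
      have h1 := Real.log_le_sub_one_of_pos (div_pos hr h)
      rw [Real.log_div hr.ne' h.ne', log_base_pow] at h1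
      have h2 := mul_le_mul_of_nonneg_left h1 h.le
      have h3 : q i * (base ^ (k + 1 + (i : ℕ)) / q i - 1) =
          base ^ (k + 1) * base ^ (i : ℕ) - q i := by
        rw [pow_add]; field_simp
      rw [h3] at h2
      rw [Real.negMulLog]
      push_cast at h2
      linarith
  refine (Finset.sum_le_sum fun i _ => hterm i).trans ?_
  rw [Finset.sum_add_distrib, ← Finset.mul_sum, Finset.sum_add_distrib, ← Finset.mul_sum,
    Finset.sum_sub_distrib, ← Finset.mul_sum, hmean, hq.2, ← geom_eq_sum_fin]
  linarith [base_pow_mul_geom_le k]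

theorem Htilde_le {γ : ℝ} {k : ℕ} (hk : 0 < k) (h0 : 0 ≤ γ) (h1 : γ ≤ 1) :
    Htilde γ k ≤ price * (1 + 1 / k + γ) / Real.log 2 := by
  have hk' : (0 : ℝ) < k := by exact_mod_cast hk
  have h := mul_le_mul_of_nonneg_left (entropy_le (isGreatest_entropySet (k := k) h0 h1).1)
    (by positivity : 0 ≤ 1 / (k : ℝ))
  refine h.trans_eq ?_
  field_simp

/-- Equality in Gibbs' inequality: the two hypotheses say that the weights themselves are a
distribution of the prescribed mean. -/
theorem Htilde_eq {γ : ℝ} {k : ℕ} (hk : 0 < k) (h0 : 0 ≤ γ) (h1 : γ ≤ 1)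
    (hsum : base ^ (k + 1) * geom k = 1)
    (hmean : base ^ (k + 1) * ∑ i ∈ Finset.range (k + 1), (i : ℝ) * base ^ i = k * γ) :
    Htilde γ k = price * (1 + 1 / k + γ) / Real.log 2 := by
  have hk' : (0 : ℝ) < k := by exact_mod_cast hk
  refine le_antisymm (Htilde_le hk h0 h1) ?_
  have hmean' : ∑ i : Fin (k + 1), ((i : ℕ) : ℝ) * (base ^ (k + 1) * base ^ (i : ℕ)) = k * γ := by
    rw [← hmean, Finset.sum_range, Finset.mul_sum]
    exact Finset.sum_congr rfl fun i _ => by ring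
  have hsum' : ∑ i : Fin (k + 1), base ^ (k + 1) * base ^ (i : ℕ) = 1 := by
    rw [← Finset.mul_sum, ← geom_eq_sum_fin, hsum]
  have hmem : price * (k + 1 + k * γ) / Real.log 2 ∈ entropySet γ k := by
    refine ⟨fun i => base ^ (k + 1) * base ^ (i : ℕ),
      ⟨⟨fun i => (mul_pos (pow_pos base_pos _) (pow_pos base_pos _)).le, hsum'⟩, hmean'⟩, ?_⟩
    rw [entropy]
    congr 1
    have hterm : ∀ i : Fin (k + 1), Real.negMulLog (base ^ (k + 1) * base ^ (i : ℕ)) =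
        price * ((k + 1) * (base ^ (k + 1) * base ^ (i : ℕ)) +
          (i : ℕ) * (base ^ (k + 1) * base ^ (i : ℕ))) := by
      intro i
      rw [Real.negMulLog, ← pow_add, log_base_pow]
      push_cast; ring
    simp only [hterm]
    rw [← Finset.mul_sum, Finset.sum_add_distrib, ← Finset.mul_sum, hsum', hmean', mul_one]
  have h := mul_le_mul_of_nonneg_left ((isGreatest_entropySet (k := k) h0 h1).2 hmem)
    (by positivity : 0 ≤ 1 / (k : ℝ))
  refine le_trans (le_of_eq ?_) h
  field_simp

theorem objective_le {α γ₁ γ₂ : ℝ} (h : Feasible α γ₁ γ₂) : objective α γ₁ γ₂ ≤ capacity := by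
  have h1 := mul_le_mul_of_nonneg_left
    (Htilde_le one_pos h.γ₁_mem.1 (h.γ₁_mem.2.trans (by norm_num))) h.α_mem.1
  have h2 := mul_le_mul_of_nonneg_left
    (Htilde_le two_pos h.γ₂_mem.1 (h.γ₂_mem.2.trans (by norm_num))) (sub_nonneg.2 h.α_mem.2)
  refine (add_le_add h1 h2).trans_eq ?_
  rw [capacity]
  push_cast
  linear_combination price / Real.log 2 * h.rate_eq

theorem exists_optimum : ∃ α γ₁ γ₂ : ℝ, Feasible α γ₁ γ₂ ∧ objective α γ₁ γ₂ = capacity ∧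
    |α - 0.177| ≤ 0.0005 ∧ |γ₁ - 0.43| ≤ 0.005 ∧ |γ₂ - 0.407| ≤ 0.0005 := by
  have hx0 := lt_base
  have hx1 := base_lt
  have h2l : (0.7548776 : ℝ) ^ 2 ≤ base ^ 2 := pow_le_pow_left₀ (by norm_num) hx0.le 2
  have h2u : base ^ 2 ≤ (0.7548777 : ℝ) ^ 2 := pow_le_pow_left₀ base_pos.le hx1.le 2
  norm_num at h2l h2u
  have e3 : base ^ 3 = 1 - base ^ 2 := by linear_combination base_eq
  have e4 : base ^ 4 = base + base ^ 2 - 1 := by linear_combination (base - 1) * base_eq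
  have e5 := base_pow_five
  -- The means of the weights for k = 1 and, halved, for k = 2, reduced modulo x^3 + x^2 - 1 to
  -- degree at most 2. Then α is forced by the rate constraint.
  obtain ⟨γ₁, hγ₁⟩ : ∃ γ₁, γ₁ = 1 - base ^ 2 := ⟨_, rfl⟩
  obtain ⟨γ₂, hγ₂⟩ : ∃ γ₂, γ₂ = (1 - base + base ^ 2) / 2 := ⟨_, rfl⟩
  have hden : 0 < γ₁ - γ₂ + 1 / 2 := by linarith
  obtain ⟨α, hα⟩ : ∃ α, α = (1 / 2 - γ₂) / (γ₁ - γ₂ + 1 / 2) := ⟨_, rfl⟩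
  have hαl : 0.1765 ≤ α := by rw [hα, le_div_iff₀ hden]; linarith
  have hαu : α ≤ 0.1775 := by rw [hα, div_le_iff₀ hden]; linarith
  have hrate : α * (γ₁ + 1) + (1 - α) * (γ₂ + 1 / 2) = 1 := by
    have : α * (γ₁ - γ₂ + 1 / 2) = 1 / 2 - γ₂ := by rw [hα, div_mul_cancel₀ _ hden.ne']
    linarith
  refine ⟨α, γ₁, γ₂, ⟨⟨by linarith, by linarith⟩, ⟨by linarith, by linarith⟩,
    ⟨by linarith, by linarith⟩, hrate⟩, ?_, ?_, ?_, ?_⟩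
  · rw [objective, Htilde_eq one_pos (by linarith) (by linarith) base_pow_mul_geom_one,
      Htilde_eq two_pos (by linarith) (by linarith) base_pow_mul_geom_two, capacity]
    · push_cast
      linear_combination price / Real.log 2 * hrate
    · norm_num [Finset.sum_range_succ]
      linear_combination e4 + 2 * e5 - 2 * hγ₂
    · norm_num [Finset.sum_range_succ]
      linear_combination e3 - hγ₁
  · rw [abs_le]; constructor <;> linarith
  · rw [abs_le]; constructor <;> linarith
  · rw [abs_le]; constructor <;> linarith

/-! ### Zero-error codebooks -/

/-- The words `e` and `e'` have the same counts at the probes of `D` and at the end. -/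
def Agree (D e e' : List Bool) : Prop :=
  ∀ s ≤ D.length, s = D.length ∨ D[s]? = some true →
    (e.take s).count true = (e'.take s).count true

theorem Agree.append {D₁ D₂ e₁ e₂ e₁' e₂' : List Bool}
    (h : Agree (D₁ ++ D₂) (e₁ ++ e₂) (e₁' ++ e₂'))
    (hl : e₁.length = D₁.length) (hl' : e₁'.length = D₁.length)
    (hc : e₁.count true = e₁'.count true) : Agree D₁ e₁ e₁' ∧ Agree D₂ e₂ e₂' := by
  constructor
  · intro s hs hsD
    rcases hs.lt_or_eq with hlt | rfl
    · have := h s (by rw [List.length_append]; omega) (Or.inr (by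
        rw [List.getElem?_append_left hlt]; exact hsD.resolve_left hlt.ne))
      rwa [List.take_append_of_le_length (by omega), List.take_append_of_le_length (by omega)]
        at this
    · rwa [List.take_of_length_le hl.le, List.take_of_length_le hl'.le]
  · intro s hs hsD
    have := h (D₁.length + s) (by rw [List.length_append]; omega) (by
      rw [List.length_append, List.getElem?_append_right (by omega), Nat.add_sub_cancel_left]
      exact hsD.imp_left (by omega))
    rw [← hl, List.take_length_add_append, hl, ← hl', List.take_length_add_append,
      List.count_append, List.count_append] at this
    omega

/-- A codebook of words of weight `w`, told apart by their counts at the probes of `D`, for which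
the number of arrivals in the first `t` slots is at least `t - l`. -/
structure IsCodebook (D : List Bool) (w l : ℕ) (E : Finset (List Bool)) : Prop where
  length_eq : ∀ e ∈ E, e.length = D.length
  count_eq : ∀ e ∈ E, e.count true = w
  le_arrivals : ∀ e ∈ E, ∀ t ≤ D.length, t ≤ l + (D.take t).count true + (e.take t).count true
  eq_of_agree : ∀ e ∈ E, ∀ e' ∈ E, Agree D e e' → e = e'

/-- There is a codebook of size `m`. -/
def HasCodebook (D : List Bool) (w l m : ℕ) : Prop := ∃ E, IsCodebook D w l E ∧ E.card = m

namespace HasCodebook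

theorem weaken {D : List Bool} {w l m : ℕ} (h : HasCodebook D w l m) :
    HasCodebook D w D.length m := by
  obtain ⟨E, hE, rfl⟩ := h
  exact ⟨E, ⟨hE.length_eq, hE.count_eq, fun _ _ t ht => by omega, hE.eq_of_agree⟩, rfl⟩

/-- Fixed weight makes the count at the seam the same for all words, so the blocks decouple. The
initial slack plus the surplus of arrivals in the first block must cover the slack needed by the
second. -/
theorem append {D₁ D₂ : List Bool} {w₁ w₂ l₁ l₂ m₁ m₂ : ℕ} (h₁ : HasCodebook D₁ w₁ l₁ m₁)
    (h₂ : HasCodebook D₂ w₂ l₂ m₂) (hl : l₂ + D₁.length ≤ l₁ + D₁.count true + w₁) :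
    HasCodebook (D₁ ++ D₂) (w₁ + w₂) l₁ (m₁ * m₂) := by
  classical
  obtain ⟨E₁, hE₁, rfl⟩ := h₁
  obtain ⟨E₂, hE₂, rfl⟩ := h₂
  refine ⟨(E₁ ×ˢ E₂).image fun p => p.1 ++ p.2, ⟨?_, ?_, ?_, ?_⟩, ?_⟩
  · intro e he
    obtain ⟨⟨e₁, e₂⟩, hp, rfl⟩ := Finset.mem_image.1 he
    rw [Finset.mem_product] at hp
    simp only [List.length_append, hE₁.length_eq _ hp.1, hE₂.length_eq _ hp.2]
  · intro e he
    obtain ⟨⟨e₁, e₂⟩, hp, rfl⟩ := Finset.mem_image.1 he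
    rw [Finset.mem_product] at hp
    simp only [List.count_append, hE₁.count_eq _ hp.1, hE₂.count_eq _ hp.2]
  · intro e he t ht
    obtain ⟨⟨e₁, e₂⟩, hp, rfl⟩ := Finset.mem_image.1 he
    rw [Finset.mem_product] at hp
    have hlen : e₁.length = D₁.length := hE₁.length_eq _ hp.1
    rcases le_total t D₁.length with h | h
    · rw [List.take_append_of_le_length h, List.take_append_of_le_length (h.trans hlen.ge)]
      exact hE₁.le_arrivals _ hp.1 t h
    · obtain ⟨s, rfl⟩ := Nat.exists_eq_add_of_le h
      rw [List.length_append] at ht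
      have h1 := hE₂.le_arrivals _ hp.2 s (by omega)
      have h2 := hE₁.count_eq _ hp.1
      rw [List.take_length_add_append, ← hlen, List.take_length_add_append]
      simp only [List.count_append] at *
      omega
  · intro e he e' he' h
    obtain ⟨⟨e₁, e₂⟩, hp, rfl⟩ := Finset.mem_image.1 he
    obtain ⟨⟨e₁', e₂'⟩, hp', rfl⟩ := Finset.mem_image.1 he'
    rw [Finset.mem_product] at hp hp'
    obtain ⟨ha, hb⟩ := h.append (hE₁.length_eq _ hp.1) (hE₁.length_eq _ hp'.1)
      (by rw [hE₁.count_eq _ hp.1, hE₁.count_eq _ hp'.1])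
    exact congrArg₂ (· ++ ·) (hE₁.eq_of_agree _ hp.1 _ hp'.1 ha)
      (hE₂.eq_of_agree _ hp.2 _ hp'.2 hb)
  · rw [Finset.card_image_of_injOn, Finset.card_product]
    rintro ⟨e₁, e₂⟩ hp ⟨e₁', e₂'⟩ hp' h
    simp only [Finset.coe_product, Set.mem_prod, Finset.mem_coe] at hp hp'
    obtain ⟨rfl, rfl⟩ := List.append_inj h
      (by rw [hE₁.length_eq _ hp.1, hE₁.length_eq _ hp'.1])
    rfl

theorem append' {D₁ D₂ : List Bool} {w₁ w₂ l₁ l₂ m₁ m₂ : ℕ} (h₁ : HasCodebook D₁ w₁ l₁ m₁)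
    (h₂ : HasCodebook D₂ w₂ l₂ m₂) :
    HasCodebook (D₁ ++ D₂) (w₁ + w₂) (D₁ ++ D₂).length (m₁ * m₂) := by
  obtain ⟨E, hE, rfl⟩ := h₁
  have h₁' : HasCodebook D₁ w₁ (D₁.length + D₂.length) E.card :=
    ⟨E, ⟨hE.length_eq, hE.count_eq, fun _ _ t ht => by omega, hE.eq_of_agree⟩, rfl⟩
  exact (h₁'.append h₂.weaken (by omega)).weaken

theorem nil (l : ℕ) : HasCodebook [] 0 l 1 :=
  ⟨{[]}, ⟨by simp, by simp, by simp, by simp⟩, rfl⟩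

theorem replicate {D : List Bool} {w l m : ℕ} (h : HasCodebook D w l m) (K : ℕ) :
    HasCodebook (List.replicate K D).flatten (K * w) (List.replicate K D).flatten.length
      (m ^ K) := by
  induction K with
  | zero => simpa using nil 0
  | succ K ih =>
    rw [List.replicate_succ, List.flatten_cons, Nat.succ_mul, Nat.add_comm, pow_succ, mul_comm (m ^ K)]
    exact h.append' ih

theorem replicate_of_busy {D : List Bool} {w l m : ℕ} (h : HasCodebook D w l m)
    (hD : D.length ≤ D.count true + w) (K : ℕ) :
    HasCodebook (List.replicate K D).flatten (K * w) l (m ^ K) := by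
  induction K with
  | zero => simpa using nil l
  | succ K ih =>
    rw [List.replicate_succ, List.flatten_cons, Nat.succ_mul, Nat.add_comm, pow_succ, mul_comm (m ^ K)]
    exact h.append ih (by omega)

/-- Both users send in every slot, which carries no information but builds a surplus of n packets to
serve as slack for what follows. -/
theorem prelude (n : ℕ) : HasCodebook (List.replicate n true) n 0 1 := by
  refine ⟨{List.replicate n true}, ⟨by simp, by simp, ?_, by simp⟩, rfl⟩
  intro e he t ht
  rw [List.length_replicate] at ht
  rw [Finset.mem_singleton.1 he, List.take_replicate, List.count_replicate_self]
  omega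

end HasCodebook

/-! ### From codebooks to codes -/

theorem stream_getD {N : ℕ} {e : List Bool} (he : e.length ≤ N) (t : ℕ) :
    stream (fun i : Fin N => e.getD i false) t = e.getD t false := by
  by_cases h : t < N
  · rw [stream_of_lt _ h]
  · simp [stream, h, List.getElem?_eq_none (show e.length ≤ t by omega)]

theorem count_stream_getD {N : ℕ} {e : List Bool} (he : e.length ≤ N) (t : ℕ) :
    count (stream fun i : Fin N => e.getD i false) t = (e.take t).count true := by
  induction t with
  | zero => simp
  | succ t ih =>
    rw [count_succ, ih, stream_getD he, List.take_add_one, List.count_append,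
      List.getD_eq_getElem?_getD]
    rcases e[t]? with _ | (_ | _) <;> simp

theorem weight_getD {N : ℕ} {e : List Bool} (he : e.length ≤ N) :
    weight (fun i : Fin N => e.getD i false) = e.count true := by
  rw [← count_stream, count_stream_getD he, List.take_of_length_le he]

/-- Slack 0 keeps the server busy throughout D, so outputs are distinct and inverting them decodes
without error. The idle padding up to N makes every probe leave before slot N and the packet rates
sum to less than 1. -/
theorem HasCodebook.exists_code {D : List Bool} {w m N : ℕ} (b : ℕ) (h : HasCodebook D w 0 m)
    (hm : 0 < m) (hN : b + D.count true + w < N) : ∃ c : Code, c.Is b N m 0 := by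
  classical
  obtain ⟨E, hE, rfl⟩ := h
  have hne : Nonempty (Fin E.card) := ⟨⟨0, hm⟩⟩
  obtain ⟨e, heE, heinj⟩ : ∃ e : Fin E.card → List Bool, (∀ i, e i ∈ E) ∧ Function.Injective e :=
    ⟨fun i => (E.equivFin.symm i : List Bool), fun i => (E.equivFin.symm i).2,
      Subtype.val_injective.comp E.equivFin.symm.injective⟩
  have hDN : D.length ≤ N := by
    have h1 := hE.le_arrivals _ (heE ⟨0, hm⟩) _ le_rfl
    rw [List.take_length, ← hE.length_eq _ (heE ⟨0, hm⟩), List.take_length,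
      hE.count_eq _ (heE _)] at h1
    have h2 := hE.length_eq _ (heE ⟨0, hm⟩)
    omega
  have heN : ∀ i, (e i).length ≤ N := fun i => (hE.length_eq _ (heE i)).trans_le hDN
  obtain ⟨d, hd⟩ : ∃ d : Fin N → Bool, d = fun i : Fin N => D.getD i false := ⟨_, rfl⟩
  obtain ⟨x, hx⟩ : ∃ x : Fin E.card → Fin N → Bool, x = fun j (i : Fin N) => (e j).getD i false :=
    ⟨_, rfl⟩
  have hcd : ∀ t, count (stream d) t = (D.take t).count true := fun t => by
    rw [hd, count_stream_getD hDN]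
  have hcx : ∀ j t, count (stream (x j)) t = ((e j).take t).count true := fun j t => by
    rw [hx, count_stream_getD (heN j)]
  have hwd : weight d = D.count true := by rw [hd, weight_getD hDN]
  have hwx : ∀ j, weight (x j) = w := fun j => by
    rw [hx, weight_getD (heN j), hE.count_eq _ (heE j)]
  have hds : ∀ s, stream d s = true ↔ D[s]? = some true := fun s => by
    rw [hd, stream_getD hDN, List.getD_eq_getElem?_getD]
    rcases D[s]? with _ | (_ | _) <;> simp
  have hdlt : ∀ s, stream d s = true → s < D.length := fun s hs =>
    (List.getElem?_eq_some_iff.1 ((hds s).1 hs)).1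
  have hbusy : ∀ j, ∀ t ≤ D.length, t ≤ b + count (stream d) t + count (stream (x j)) t := by
    intro j t ht
    have := hE.le_arrivals _ (heE j) t ht
    rw [hcd, hcx]
    omega
  have hinj : Function.Injective fun j => probeOutput b (stream d) (stream (x j)) := by
    intro j j' hjj
    have hcount := count_eq_of_probeOutput_eq (fun s hs => (hdlt s hs).le) (hbusy j) (hbusy j') hjj
    refine heinj (hE.eq_of_agree _ (heE j) _ (heE j') fun s hs hsD => ?_)
    rcases hsD with rfl | hsD
    · rw [List.take_of_length_le (hE.length_eq _ (heE j)).le,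
        List.take_of_length_le (hE.length_eq _ (heE j')).le, hE.count_eq _ (heE j),
        hE.count_eq _ (heE j')]
    · rw [← hcx, ← hcx]
      exact hcount s ((hds s).2 hsD)
  have htime : ∀ j, receptionTime b d (x j) = N := by
    intro j
    refine le_antisymm (Nat.sInf_le ⟨le_rfl, fun t ht => ?_⟩) (le_receptionTime b d (x j))
    rw [Bool.eq_false_iff]
    intro hout
    obtain ⟨s, hs, rfl⟩ := (probeOutput_eq_true_iff ..).1 hout
    rw [backlog_eq_of_busy (hbusy j) (hdlt s hs).le] at ht
    have h1 := count_mono (stream d) ((hdlt s hs).le.trans hDN)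
    have h2 := count_mono (stream (x j)) ((hdlt s hs).le.trans hDN)
    rw [count_stream] at h1 h2
    rw [hwd] at h1
    rw [hwx] at h2
    omega
  have hNpos : 0 < N := by omega
  obtain ⟨c, hc⟩ : ∃ c : Code, c = ⟨N, hNpos, E.card, hm, x, Pi.single d 1,
      single_mem_stdSimplex ℝ d,
      fun _ => Function.invFun fun j => probeOutput b (stream d) (stream (x j))⟩ := ⟨_, rfl⟩
  have hmean : ∀ f : (Fin N → Bool) → Fin E.card → ℝ, ∀ a : ℝ, (∀ j, f d j = a) →
      ∑ d', (Pi.single d 1 : (Fin N → Bool) → ℝ) d' * ((1 / (E.card : ℝ)) * ∑ j, f d' j) = a := by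
    intro f a hf
    have hm' : (E.card : ℝ) ≠ 0 := by exact_mod_cast hm.ne'
    rw [Finset.sum_eq_single d (fun d' _ hne => by simp [hne]) (by simp)]
    simp only [hf, Pi.single_eq_same, Finset.sum_const, Finset.card_univ, Fintype.card_fin,
      nsmul_eq_mul]
    field_simp
  refine ⟨c, ?_, ?_, ?_, ?_⟩
  · rw [hc]
  · rw [hc]
    exact hmean _ _ fun j => by exact_mod_cast htime j
  · rw [hc]
    refine (hmean _ 0 fun j => ?_).le
    exact if_pos (Function.leftInverse_invFun hinj j)
  · have h1 : c.encRate = w / N := by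
      rw [hc]
      exact hmean _ _ fun j => by rw [hwx]
    have h2 : c.probeRate = (D.count true : ℕ) / N := by
      rw [hc]
      exact hmean _ _ fun j => by rw [hwd]
    rw [h1, h2, ← add_div, div_lt_one (by exact_mod_cast hNpos)]
    exact_mod_cast (by omega : w + D.count true < N)

/-! ### Periodic probe streams -/

/-- `j` packets followed by idle slots, in `k` slots. -/
def packets (k j : ℕ) : List Bool := List.replicate j true ++ List.replicate (k - j) false

/-- `A` periods of length `k`, each of them starting with a probe packet. -/
def periodic (k A : ℕ) : List Bool := (List.replicate A (packets k 1)).flatten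

theorem length_packets {k j : ℕ} (h : j ≤ k) : (packets k j).length = k := by
  simp [packets, h]

theorem count_packets (k j : ℕ) : (packets k j).count true = j := by
  simp [packets, List.count_replicate]

theorem length_periodic {k : ℕ} (hk : 0 < k) (A : ℕ) : (periodic k A).length = A * k := by
  simp [periodic, length_packets (Nat.succ_le_of_lt hk)]

theorem count_periodic (k A : ℕ) : (periodic k A).count true = A := by
  simp [periodic, List.count_flatten, count_packets]

theorem length_flatMap_packets {k : ℕ} {l : List ℕ} (h : ∀ j ∈ l, j ≤ k) :
    (l.flatMap (packets k)).length = l.length * k := by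
  induction l with
  | nil => simp
  | cons j l ih =>
    rw [List.forall_mem_cons] at h
    rw [List.flatMap_cons, List.length_append, ih h.2, length_packets h.1, List.length_cons]
    ring

theorem count_flatMap_packets (k : ℕ) (l : List ℕ) :
    (l.flatMap (packets k)).count true = l.sum := by
  induction l with
  | nil => simp
  | cons j l ih => rw [List.flatMap_cons, List.count_append, ih, count_packets, List.sum_cons]

theorem eq_of_agree_periodic {k : ℕ} (hk : 0 < k) {l l' : List ℕ} (h : ∀ j ∈ l, j ≤ k)
    (h' : ∀ j ∈ l', j ≤ k) (hl : l.length = l'.length)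
    (ha : Agree (periodic k l.length) (l.flatMap (packets k)) (l'.flatMap (packets k))) :
    l = l' := by
  induction l generalizing l' with
  | nil => exact (List.length_eq_zero_iff.1 hl.symm).symm
  | cons j l ih =>
    rcases l' with _ | ⟨j', l'⟩
    · simp at hl
    rw [List.forall_mem_cons] at h h'
    have hper : periodic k (j :: l).length = packets k 1 ++ periodic k l.length := by
      rw [periodic, List.length_cons, List.replicate_succ, List.flatten_cons]; rfl
    rw [hper, List.flatMap_cons, List.flatMap_cons] at ha
    have hp : (packets k 1).length = k := length_packets hk
    have hj : j = j' := by
      -- Slot k is either the start of the next period, hence a probe, or the end of the word. In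
      -- both cases its count reveals j.
      have h1 := ha k (by rw [List.length_append, hp]; omega) (by
        rw [List.length_append, hp, List.getElem?_append_right (by omega), hp, Nat.sub_self]
        rcases Nat.eq_zero_or_pos l.length with h0 | h0
        · left; simp [h0, periodic]
        · right
          obtain ⟨n, hn⟩ := Nat.exists_eq_succ_of_ne_zero h0.ne'
          simp [hn, periodic, packets, List.replicate_succ])
      rwa [List.take_append_of_le_length (length_packets h.1).ge,
        List.take_append_of_le_length (length_packets h'.1).ge,
        List.take_of_length_le (length_packets h.1).le,
        List.take_of_length_le (length_packets h'.1).le, count_packets, count_packets] at h1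
    subst hj
    rw [ih h.2 h'.2 (by simpa using hl) (ha.append (by rw [hp, length_packets h.1])
      (by rw [hp, length_packets h.1]) rfl).2]

theorem hasCodebook_periodic {k : ℕ} (hk : 0 < k) (A s : ℕ) :
    HasCodebook (periodic k A) s (periodic k A).length
      (Finset.univ.filter fun f : Fin A → Fin (k + 1) => ∑ i, (f i : ℕ) = s).card := by
  classical
  have hle : ∀ f : Fin A → Fin (k + 1), ∀ j ∈ List.ofFn fun i => (f i : ℕ), j ≤ k := by
    intro f j hj
    obtain ⟨i, rfl⟩ := List.mem_ofFn.1 hj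
    exact Nat.lt_succ_iff.1 (f i).2
  have hkey : ∀ f f' : Fin A → Fin (k + 1), Agree (periodic k A)
      ((List.ofFn fun i => (f i : ℕ)).flatMap (packets k))
      ((List.ofFn fun i => (f' i : ℕ)).flatMap (packets k)) → f = f' := by
    intro f f' h
    have h1 := eq_of_agree_periodic hk (hle f) (hle f') (by simp) (by simpa using h)
    funext i
    exact Fin.ext (congrFun (List.ofFn_injective h1) i)
  refine ⟨(Finset.univ.filter fun f : Fin A → Fin (k + 1) => ∑ i, (f i : ℕ) = s).image
    fun f => (List.ofFn fun i => (f i : ℕ)).flatMap (packets k), ⟨?_, ?_, ?_, ?_⟩, ?_⟩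
  · intro e he
    obtain ⟨f, -, rfl⟩ := Finset.mem_image.1 he
    rw [length_flatMap_packets (hle f), length_periodic hk, List.length_ofFn]
  · intro e he
    obtain ⟨f, hf, rfl⟩ := Finset.mem_image.1 he
    rw [count_flatMap_packets, List.sum_ofFn, (Finset.mem_filter.1 hf).2]
  · intro e _ t ht
    omega
  · intro e he e' he' h
    obtain ⟨f, -, rfl⟩ := Finset.mem_image.1 he
    obtain ⟨f', -, rfl⟩ := Finset.mem_image.1 he'
    rw [hkey f f' h]
  · refine Finset.card_image_of_injective _ fun f f' h => hkey f f' ?_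
    beta_reduce at h
    rw [h]
    exact fun _ _ _ => rfl

/-- Some weight class of at most half the maximal weight is exponentially as large as the
weighted sum over all words. -/
theorem exists_large_weight_class (k A : ℕ) : ∃ s, 2 * s ≤ k * A ∧
    geom k ^ A ≤ (k * A + 1) *
      ((Finset.univ.filter fun f : Fin A → Fin (k + 1) => ∑ i, (f i : ℕ) = s).card *
        base ^ s) := by
  classical
  obtain ⟨cl, hcl⟩ : ∃ cl : ℕ → Finset (Fin A → Fin (k + 1)), ∀ s,
      cl s = Finset.univ.filter fun f : Fin A → Fin (k + 1) => ∑ i, (f i : ℕ) = s :=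
    ⟨_, fun _ => rfl⟩
  simp only [← hcl]
  have hle : ∀ f : Fin A → Fin (k + 1), ∑ i, (f i : ℕ) ≤ k * A := fun f =>
    (Finset.sum_le_card_nsmul _ _ k fun i _ => Nat.lt_succ_iff.1 (f i).2).trans_eq
      (by simp [mul_comm])
  have htot : geom k ^ A = ∑ s ∈ Finset.range (k * A + 1), ((cl s).card : ℝ) * base ^ s := by
    rw [geom_eq_sum_fin, Fintype.sum_pow]
    simp only [Finset.prod_pow_eq_pow_sum]
    rw [← Finset.sum_fiberwise_of_maps_to (g := fun f : Fin A → Fin (k + 1) => ∑ i, (f i : ℕ))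
      (t := Finset.range (k * A + 1)) fun f _ => Finset.mem_range.2 (Nat.lt_succ_of_le (hle f))]
    refine Finset.sum_congr rfl fun s _ => ?_
    rw [hcl, ← nsmul_eq_mul]
    exact Finset.sum_eq_card_nsmul fun f hf => by rw [(Finset.mem_filter.1 hf).2]
  -- Pigeonhole over the kA + 1 possible weights.
  obtain ⟨s, hs, hbig⟩ : ∃ s ∈ Finset.range (k * A + 1),
      geom k ^ A ≤ (k * A + 1) * (((cl s).card : ℝ) * base ^ s) := by
    by_contra! hlt
    have := Finset.sum_lt_sum_of_nonempty (Finset.nonempty_range_iff.2 (Nat.succ_ne_zero _)) hlt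
    rw [← Finset.mul_sum, ← htot, Finset.sum_const, Finset.card_range, nsmul_eq_mul] at this
    push_cast at this
    exact lt_irrefl _ this
  rw [Finset.mem_range] at hs
  rcases le_or_gt (2 * s) (k * A) with h | h
  · exact ⟨s, h, hbig⟩
  -- Replacing each letter by its complement to k maps the class s into the class kA - s, and the
  -- smaller weight has the larger factor x^s.
  · refine ⟨k * A - s, by omega, hbig.trans ?_⟩
    refine mul_le_mul_of_nonneg_left ?_ (by positivity)
    have hcard : (cl s).card ≤ (cl (k * A - s)).card := by
      refine Finset.card_le_card_of_injOn (fun f i => (f i).rev) ?_ ?_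
      · intro f hf
        rw [Finset.mem_coe, hcl, Finset.mem_filter] at hf ⊢
        refine ⟨Finset.mem_univ _, ?_⟩
        have : ∑ i, ((f i).rev : ℕ) + ∑ i, (f i : ℕ) = k * A := by
          rw [← Finset.sum_add_distrib, Finset.sum_congr rfl fun i _ => show
            ((f i).rev : ℕ) + f i = k by rw [Fin.val_rev]; omega]
          simp [mul_comm]
        simp only
        omega
      · intro f _ f' _ h
        funext i
        exact Fin.rev_injective (congrFun h i)
    exact mul_le_mul (by exact_mod_cast hcard)
      (pow_le_pow_of_le_one base_pos.le base_lt_one.le (by omega)) (pow_pos base_pos _).le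
      (Nat.cast_nonneg _)

theorem exists_periodic_codebook {k : ℕ} (hk : 0 < k) (A : ℕ) : ∃ s m : ℕ, 2 * s ≤ k * A ∧ 0 < m ∧
    HasCodebook (periodic k A) s (periodic k A).length m ∧
    A * Real.log (geom k) + s * price - Real.log (k * A + 1) ≤ Real.log m := by
  obtain ⟨s, hs, h⟩ := exists_large_weight_class k A
  refine ⟨s, _, hs, ?_, hasCodebook_periodic hk A s, ?_⟩
  · rw [Nat.pos_iff_ne_zero]
    intro h0
    rw [h0] at h
    have := pow_pos (geom_pos k) A
    simp at h
    linarith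
  · have h1 := Real.log_le_log (pow_pos (geom_pos k) A) h
    have hm := (pow_pos (geom_pos k) A).trans_le h
    have h2 : (0 : ℝ) < k * A + 1 := by positivity
    have h3 := pos_of_mul_pos_right hm h2.le
    have h4 := left_ne_zero_of_mul h3.ne'
    rw [Real.log_mul h2.ne' h3.ne', Real.log_mul h4 (pow_pos base_pos _).ne', log_base_pow,
      Real.log_pow] at h1
    linarith

/-! ### Achievability -/

/-- A codebook without drift whose rate is nearly the capacity. -/
theorem exists_balanced_codebook {η : ℝ} (hη : 0 < η) : ∃ (D : List Bool) (w m : ℕ),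
    HasCodebook D w D.length m ∧ D.length = D.count true + w ∧ 0 < D.length ∧ 0 < m ∧
      (2 * price - η) * D.length ≤ Real.log m := by
  -- The bound by η controls the rate loss. The bound by `price` rules out the one-word class s₁ =
  -- 0, which would allow an empty mixture.
  obtain ⟨A, hA, hlog⟩ : ∃ A : ℕ, 0 < A ∧ Real.log (2 * A + 1) ≤ min η price * A := by
    have hpos : 0 < min η price := lt_min hη price_pos
    have h1 : Tendsto (fun A : ℕ => (2 * A + 1 : ℝ)) atTop atTop :=
      tendsto_atTop_add_const_right _ _
        (tendsto_natCast_atTop_atTop.const_mul_atTop two_pos)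
    have h2 := h1.eventually
      (Real.isLittleO_log_id_atTop.bound (show 0 < min η price / 3 by positivity))
    obtain ⟨A, hA, hb⟩ := ((eventually_gt_atTop 0).and h2).exists
    refine ⟨A, hA, (le_abs_self _).trans (hb.trans ?_)⟩
    have hA1 : (1 : ℝ) ≤ A := by exact_mod_cast hA
    rw [id, Real.norm_of_nonneg (by positivity)]
    nlinarith
  have hA' : (0 : ℝ) < A := by exact_mod_cast hA
  obtain ⟨s₁, m₁, -, hm₁, hc₁, hl₁⟩ := exists_periodic_codebook one_pos A
  obtain ⟨s₂, m₂, hs₂, hm₂, hc₂, hl₂⟩ := exists_periodic_codebook two_pos A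
  rw [log_geom_one] at hl₁
  rw [log_geom_two] at hl₂
  push_cast at hl₁ hl₂
  have hlog₁ : Real.log (1 * A + 1) ≤ min η price * A :=
    (Real.log_le_log (by positivity) (by linarith)).trans hlog
  have hη' : min η price * A ≤ η * A := mul_le_mul_of_nonneg_right (min_le_left _ _) hA'.le
  have hprice : min η price * A ≤ price * A := mul_le_mul_of_nonneg_right (min_le_right _ _) hA'.le
  have hs₁ : 0 < s₁ := by
    rw [Nat.pos_iff_ne_zero]
    rintro rfl
    obtain ⟨E, hE, hcard⟩ := hc₁
    have hone : m₁ ≤ 1 := by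
      rw [← hcard]
      refine Finset.card_le_one.2 fun e he e' he' => ?_
      have hzero : ∀ f ∈ E, f = List.replicate (periodic 1 A).length false := fun f hf =>
        List.eq_replicate_iff.2 ⟨hE.length_eq f hf, fun x hx => by
          have := List.count_eq_zero.1 (hE.count_eq f hf)
          cases x
          · rfl
          · exact absurd hx this⟩
      rw [hzero e he, hzero e' he']
    obtain rfl : m₁ = 1 := by omega
    have := mul_pos hA' price_pos
    simp only [Nat.cast_one, Real.log_one, Nat.cast_zero, zero_mul] at hl₁
    nlinarith
  -- A period-1 block has s₁ packets more than slots, a period-2 block A - s₂ = r fewer. Hence r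
  -- copies of the former balance s₁ copies of the latter; 2 s₂ ≤ 2A makes r a natural number.
  obtain ⟨r, hr⟩ : ∃ r, r + s₂ = A := ⟨A - s₂, by omega⟩
  have hr' : (r : ℝ) + s₂ = A := by exact_mod_cast hr
  have hcode := (hc₁.replicate r).append' (hc₂.replicate s₁)
  have hlen : ((List.replicate r (periodic 1 A)).flatten ++
      (List.replicate s₁ (periodic 2 A)).flatten).length = r * A + s₁ * (A * 2) := by
    simp [length_periodic]
  have hcount : ((List.replicate r (periodic 1 A)).flatten ++
      (List.replicate s₁ (periodic 2 A)).flatten).count true = r * A + s₁ * A := by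
    simp [List.count_flatten, count_periodic]
  refine ⟨_, _, _, hcode, ?_, ?_, by positivity, ?_⟩
  · rw [hlen, hcount]
    subst hr
    ring
  · rw [hlen]
    have := Nat.mul_pos hs₁ hA
    nlinarith
  · rw [hlen]
    push_cast
    rw [Real.log_mul (by positivity) (by positivity), Real.log_pow, Real.log_pow]
    have h1 : r * (A * (2 * price) + s₁ * price - η * A) ≤ r * Real.log m₁ :=
      mul_le_mul_of_nonneg_left (by linarith) (Nat.cast_nonneg _)
    have h2 : s₁ * (A * (3 * price) + s₂ * price - η * A) ≤ s₁ * Real.log m₂ :=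
      mul_le_mul_of_nonneg_left (by linarith) (Nat.cast_nonneg _)
    have h3 : (0 : ℝ) ≤ s₁ * (η * A) := by positivity
    have h4 : (s₂ : ℝ) = A - r := by linarith
    rw [h4] at h2
    nlinarith

theorem achievable_capacity (b : ℕ) : Achievable b capacity := by
  have hlog2 : 0 < Real.log 2 := Real.log_pos one_lt_two
  intro δ hδ
  obtain ⟨D, w, m, hcode, hbal, hpos, hm, hrate⟩ :=
    exists_balanced_codebook (η := δ * Real.log 2 / 2) (by positivity)
  have hpos' : (0 : ℝ) < D.length := by exact_mod_cast hpos
  -- The K balanced blocks bring K * D.length packets, the prelude 2 * D.length and the initial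
  -- queue b. One more slot gives strict inequality, and the overhead does not depend on K.
  obtain ⟨n, hn⟩ : ∃ n : ℕ → ℕ, ∀ K, n K = K * D.length + (b + 2 * D.length + 1) :=
    ⟨_, fun _ => rfl⟩
  have hcodes : ∀ K, ∃ c : Code, c.Is b (n K) (m ^ K) 0 := by
    intro K
    have h := (HasCodebook.prelude D.length).append (hcode.replicate_of_busy hbal.le K) (by simp)
    rw [one_mul] at h
    refine h.exists_code b (pow_pos hm K) ?_
    have h1 : ((List.replicate K D).flatten).count true = K * D.count true := by
      simp [List.count_flatten]
    rw [List.count_append, List.count_replicate_self, h1, hn]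
    nlinarith
  have hlim : Tendsto (fun K : ℕ => (K : ℝ) * Real.log m / n K) atTop
      (𝓝 (Real.log m / D.length)) := by
    have h1 : Tendsto (fun K : ℕ => Real.log m /
        (D.length + ((b + 2 * D.length + 1 : ℕ) : ℝ) / (K : ℝ))) atTop
        (𝓝 (Real.log m / (D.length + 0))) :=
      tendsto_const_nhds.div (tendsto_const_nhds.add (tendsto_const_div_atTop_nhds_zero_nat _))
        (by rw [add_zero]; exact hpos'.ne')
    rw [add_zero] at h1
    refine h1.congr' ?_
    filter_upwards [eventually_gt_atTop 0] with K hK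
    have hK' : (0 : ℝ) < K := by exact_mod_cast hK
    rw [hn]
    push_cast
    field_simp
  have hlt : (capacity - δ) * Real.log 2 < Real.log m / D.length := by
    rw [lt_div_iff₀ hpos', capacity]
    refine lt_of_lt_of_le ?_ hrate
    refine mul_lt_mul_of_pos_right ?_ hpos'
    rw [sub_mul, div_mul_cancel₀ _ hlog2.ne']
    linarith [mul_pos hδ hlog2]
  obtain ⟨K₀, hK₀⟩ := eventually_atTop.1 (hlim.eventually_const_lt hlt)
  -- Shifted by K₀ because the rate bound is required for every index, not only eventually.
  refine ⟨fun k => n (K₀ + k), fun k => m ^ (K₀ + k), fun _ => 0, fun k => hcodes _, fun k => ?_,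
    ?_, tendsto_const_nhds⟩
  · have h1 := hK₀ (K₀ + k) (Nat.le_add_right _ _)
    rw [Real.logb, Nat.cast_pow, Real.log_pow, div_right_comm, lt_div_iff₀ hlog2]
    exact h1
  · refine tendsto_natCast_atTop_atTop.comp (tendsto_atTop_mono (fun k => ?_) tendsto_id)
    rw [hn, id]
    nlinarith

theorem isCapacity_capacity (b : ℕ) : IsCapacity b capacity :=
  ⟨fun _ hR => hR.le_capacity, fun _ h => h (achievable_capacity b)⟩

end CovertQueue

end

theorem theorem1 :
    ∃ C : ℝ,
      -- `C` is the capacity, whatever number `b` of packets is buffered at time zero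
      (∀ b : ℕ, CovertQueue.IsCapacity b C) ∧
      -- it is the maximum of the optimization problem
      IsGreatest {v : ℝ | ∃ α γ₁ γ₂ : ℝ, CovertQueue.Feasible α γ₁ γ₂ ∧
        v = CovertQueue.objective α γ₁ γ₂} C ∧
      -- numerical values, to the digits given
      |C - 0.8114| ≤ 0.00005 ∧
      ∃ α γ₁ γ₂ : ℝ, CovertQueue.Feasible α γ₁ γ₂ ∧ CovertQueue.objective α γ₁ γ₂ = C ∧
        |α - 0.177| ≤ 0.0005 ∧ |γ₁ - 0.43| ≤ 0.005 ∧ |γ₂ - 0.407| ≤ 0.0005 := by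
  obtain ⟨α, γ₁, γ₂, h, hC, hα, hγ₁, hγ₂⟩ := CovertQueue.exists_optimum
  have hmem := CovertQueue.capacity_mem
  refine ⟨CovertQueue.capacity, CovertQueue.isCapacity_capacity, ⟨⟨α, γ₁, γ₂, h, hC.symm⟩, ?_⟩, ?_,
    α, γ₁, γ₂, h, hC, hα, hγ₁, hγ₂⟩
  · rintro v ⟨α', γ₁', γ₂', h', rfl⟩
    exact CovertQueue.objective_le h'
  · rw [abs_le]
    constructor <;> linarith [hmem.1, hmem.2]
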